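/- All groups are discrete. Let $\Delta\Gamma$ be the Stone–Čech compactification of a group $\Gamma$ and $\partial\Gamma=\Delta\Gamma\setminus\Gamma$. Given a continuous action of $\Gamma$ on a compact Hausdorff space $K$ and a regular Borel probability measure $\eta$ on $K$, let $\partial_\eta\Gamma$ be the set of all $\omega\in\Delta\Gamma$ such that, for every $h\in\Gamma$, $(gh)\cdot\eta-g\cdot\eta\to 0$ in the weak-* topology as $g\to\omega$. The group $\Gamma$ is called *properly proximal* if there is a nonempty finite family of continuous actions $\Gamma\curvearrowright K_i$ on compact Hausdorff spaces with regular Borel probability measures $\eta_i$ on $K_i$ such that no $K_i$ carries a $\Gamma$-invariant Borel probability measure and $\bigcup_i\partial_{\eta_i}\Gamma=\partial\Gamma$. A subgroup $\Lambda\le\Gamma$ is *co-amenable* if there is a $\Gamma$-invariant mean on $\ell^\infty(\Gamma/\Lambda)$. Groups $\Gamma,\Gamma'$ are *commensurable up to finite kernels* if there are finite-index subgroups $\Gamma_0\le\Gamma$, $\Gamma_0'\le\Gamma'$ and finite normal subgroups $N\lhd\Gamma_0$, $N'\lhd\Gamma_0'$ with $\Gamma_0/N\cong\Gamma_0'/N'$.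 The following hold. 1. The direct product of a nonempty finite family of properly proximal groups is properly proximal. 2. Every co-amenable subgroup of a properly proximal group is properly proximal. Every finite-index subgroup of a group is co-amenable; in particular, finite-index subgroups of properly proximal groups are properly proximal. 3. If two countable groups are commensurable up to finite kernels, then one of them is properly proximal if and only if the other is. -/

import Mathlib

open MeasureTheory Filter Topology

open scoped ENNReal

universe u v w

/-- The Stone–Čech boundary `∂G = ΔG \ G` of the discrete group `G`: the Stone–Čech
compactification of a discrete set is its space of ultrafilters, the points of `G` being the
principal ultrafilters. -/
def stoneCechBoundary (G : Type u) : Set (Ultrafilter G) :=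
  (Set.range (pure : G → Ultrafilter G))ᶜ

/-- An action of the discrete group `G` by homeomorphisms on a compact Hausdorff space,
together with a regular Borel probability measure `η` on that space. -/
structure CompactProbAction (G : Type u) [Group G] where
  space : Type u
  [topology : TopologicalSpace space]
  [compact : CompactSpace space]
  [hausdorff : T2Space space]
  [measurable : MeasurableSpace space]
  [borel : BorelSpace space]
  [action : MulAction G space]
  [continuous_action : ContinuousConstSMul G space]
  η : Measure space
  [probability : IsProbabilityMeasure η]
  [regular : η.Regular]

namespace CompactProbAction

attribute [instance] topology compact hausdorff measurable borel action continuous_action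
  probability regular

variable {G : Type u} [Group G] (A : CompactProbAction G)

/-- The translate `g · η` of the measure: its push-forward under `x ↦ g • x`. -/
noncomputable def translate (g : G) : Measure A.space :=
  A.η.map (fun x => g • x)

/-- The set `∂_η G` of `η`-proximal elements of `ΔG`: those ultrafilters `ω` such that, for all
`h`, the difference `(gh) · η - g · η` tends to `0` in the weak-* topology as `g → ω`. -/
def proximalSet : Set (Ultrafilter G) :=
  {ω | ∀ (h : G) (f : C(A.space, ℝ)),
    Tendsto (fun g : G => (∫ x, f x ∂(A.translate (g * h))) - ∫ x, f x ∂(A.translate g))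
      (ω : Filter G) (𝓝 0)}

/-- There is a `G`-invariant Borel probability measure on the space. -/
def HasInvariantProb : Prop :=
  ∃ μ : Measure A.space, IsProbabilityMeasure μ ∧ SMulInvariantMeasure G A.space μ

end CompactProbAction

/-- The discrete group `G` is properly proximal: there is a finite nonempty family of actions on
compact spaces `K i` with probability measures `η i`, none of which has an invariant probability
measure, and such that the union of the sets of `η i`-proximal elements is the Stone–Čech
boundary of `G`. -/
def IsProperlyProximal (G : Type u) [Group G] : Prop :=
  ∃ (ι : Type) (_ : Finite ι) (_ : Nonempty ι) (A : ι → CompactProbAction G),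
    (∀ i, ¬ (A i).HasInvariantProb) ∧ ⋃ i, (A i).proximalSet = stoneCechBoundary G

/-- Translation by `g` on bounded real functions on a `G`-set: `(g · f) x = f (g⁻¹ • x)`. -/
def linftyTranslate {G : Type u} [Group G] {X : Type v} [MulAction G X] (g : G)
    (f : lp (fun _ : X => ℝ) ∞) : lp (fun _ : X => ℝ) ∞ :=
  ⟨fun x => f (g⁻¹ • x), by
    obtain ⟨C, hC⟩ := memℓp_infty_iff.1 (lp.memℓp f)
    refine memℓp_infty ⟨C, ?_⟩
    rintro _ ⟨x, rfl⟩
    exact hC ⟨g⁻¹ • x, rfl⟩⟩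

/-- The subgroup `H` of `G` is co-amenable: there is a `G`-invariant mean (state) on
`ℓ^∞(G ⧸ H)`. -/
def Subgroup.IsCoamenable {G : Type u} [Group G] (H : Subgroup G) : Prop :=
  ∃ m : lp (fun _ : G ⧸ H => ℝ) ∞ →ₗ[ℝ] ℝ,
    m 1 = 1 ∧ (∀ f : lp (fun _ : G ⧸ H => ℝ) ∞, (∀ x, 0 ≤ f x) → 0 ≤ m f) ∧
      ∀ (g : G) (f : lp (fun _ : G ⧸ H => ℝ) ∞), m (linftyTranslate g f) = m f

/-- `G` and `H` are commensurable up to finite kernels: some finite-index subgroups of `G` and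
`H` have isomorphic quotients by finite normal subgroups. -/
def CommensurableUpToFiniteKernels (G : Type u) (H : Type v) [Group G] [Group H] : Prop :=
  ∃ (G₀ : Subgroup G) (H₀ : Subgroup H) (N : Subgroup G₀) (M : Subgroup H₀)
    (_ : N.Normal) (_ : M.Normal),
    G₀.FiniteIndex ∧ H₀.FiniteIndex ∧ Finite N ∧ Finite M ∧ Nonempty (G₀ ⧸ N ≃* H₀ ⧸ M)

/-! By Hahn–Banach and Riesz representation, a compact `G`-space has no invariant probability
measure exactly when there is a finite certificate: `f k` continuous and `g k` in `G` with `∑ k, (f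
k (g k • x) - f k x) ≥ 1` everywhere. Integrating over translates of `η` (`poisson`) turns a
certificate into bounded functions on `G` with the same inequality for left translations;
proximality at `ω` says that these functions are asymptotically right invariant along `ω`.

For products, the actions of the factors are pulled back along the projections: a nonprincipal
ultrafilter on a finite product has a nonprincipal projection. For a co-amenable `H`, the actions
are restricted: an `H`-invariant measure would turn the certificate into functions on `G ⧸ H`, where
an invariant mean yields `1 ≤ 0`.

For commensurability, proper proximality is replaced by the intrinsic condition
`HasAsymptoticParadox`, obtained by gluing the functions of the several actions with slowly varying
cutoffs. It passes through finite kernels in both directions and up from finite-index subgroups. In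
a countable group, a diagonal Cesàro average produces one asymptotically right invariant family; the
orbit closure of its left translates, with a point mass, is a single action witnessing proper
proximality. -/

/-! ### Invariant functionals and measures -/

section Functional

/-- A unital positive linear functional on `C(K, ℝ)` is integration against a regular Borel
probability measure. -/
theorem exists_regular_probability_integral_eq {K : Type*} [TopologicalSpace K] [CompactSpace K]
    [T2Space K] [MeasurableSpace K] [BorelSpace K] (φ : C(K, ℝ) →ₗ[ℝ] ℝ)
    (hpos : ∀ f : C(K, ℝ), (∀ x, 0 ≤ f x) → 0 ≤ φ f) (hone : φ 1 = 1) :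
    ∃ μ : Measure K, IsProbabilityMeasure μ ∧ μ.Regular ∧ ∀ f : C(K, ℝ), ∫ x, f x ∂μ = φ f := by
  let toC : CompactlySupportedContinuousMap K ℝ →ₗ[ℝ] C(K, ℝ) :=
    { toFun := fun f => ⟨f, f.continuous⟩
      map_add' := fun _ _ => rfl
      map_smul' := fun _ _ => rfl }
  let Λ : CompactlySupportedContinuousMap K ℝ →ₚ[ℝ] ℝ :=
    PositiveLinearMap.mk₀ (φ ∘ₗ toC) (fun f hf => hpos _ (fun x => hf x))
  have hint : ∀ f : C(K, ℝ), ∫ x, f x ∂(RealRMK.rieszMeasure Λ) = φ f := fun f =>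
    RealRMK.integral_rieszMeasure Λ (CompactlySupportedContinuousMap.continuousMapEquiv f)
  refine ⟨RealRMK.rieszMeasure Λ, ⟨?_⟩, inferInstance, hint⟩
  have h1 := hint 1
  simp only [ContinuousMap.one_apply, integral_const, smul_eq_mul, mul_one, hone] at h1
  rw [measureReal_def] at h1
  rw [← ENNReal.ofReal_toReal (a := RealRMK.rieszMeasure Λ Set.univ)
    (isCompact_univ.measure_lt_top.ne), h1, ENNReal.ofReal_one]

theorem integrable_continuousMap {K : Type*} [TopologicalSpace K] [CompactSpace K]
    [MeasurableSpace K] [BorelSpace K] (μ : Measure K) [IsFiniteMeasure μ] (f : C(K, ℝ)) :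
    Integrable f μ :=
  f.continuous.integrable_of_hasCompactSupport (HasCompactSupport.of_compactSpace f)

theorem one_le_sum_integral_sub {K κ : Type*} [TopologicalSpace K] [CompactSpace K]
    [MeasurableSpace K] [BorelSpace K] (μ : Measure K) [IsProbabilityMeasure μ] [Fintype κ]
    {u v : κ → C(K, ℝ)} (h : ∀ x, 1 ≤ ∑ k, (u k x - v k x)) :
    1 ≤ ∑ k, (∫ x, u k x ∂μ - ∫ x, v k x ∂μ) := by
  have hi : ∀ k, Integrable (fun x => u k x - v k x) μ := fun k =>
    integrable_continuousMap μ (u k - v k)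
  have h1 : ∑ k, (∫ x, u k x ∂μ - ∫ x, v k x ∂μ) = ∫ x, ∑ k, (u k x - v k x) ∂μ := by
    rw [integral_finsetSum _ fun k _ => hi k]
    exact Finset.sum_congr rfl fun k _ => (integral_sub (integrable_continuousMap μ (u k))
      (integrable_continuousMap μ (v k))).symm
  rw [h1]
  calc (1 : ℝ) = ∫ _, (1 : ℝ) ∂μ := by simp
    _ ≤ _ := integral_mono (integrable_const _) (integrable_finsetSum _ fun k _ => hi k) h

end Functional

/-- The composition of `f` with the homeomorphism `x ↦ g • x`. -/
def ContinuousMap.smulComp {G K : Type*} [Group G] [TopologicalSpace K] [MulAction G K]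
    [ContinuousConstSMul G K] (g : G) (f : C(K, ℝ)) : C(K, ℝ) :=
  ⟨fun x => f (g • x), f.continuous.comp (continuous_const_smul g)⟩

@[simp]
theorem ContinuousMap.smulComp_apply {G K : Type*} [Group G] [TopologicalSpace K] [MulAction G K]
    [ContinuousConstSMul G K] (g : G) (f : C(K, ℝ)) (x : K) : f.smulComp g x = f (g • x) :=
  rfl

/-- If no combination of differences `f (g • x) - f x` is bounded below by `1`, then there is a
unital positive functional which vanishes on all these differences. -/
theorem exists_invariant_functional {G K : Type*} [Group G] [TopologicalSpace K] [CompactSpace K]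
    [Nonempty K] [MulAction G K] [ContinuousConstSMul G K]
    (h : ¬ ∃ (n : ℕ) (f : Fin n → C(K, ℝ)) (g : Fin n → G),
      ∀ x, 1 ≤ ∑ k, (f k (g k • x) - f k x)) :
    ∃ φ : C(K, ℝ) →ₗ[ℝ] ℝ, (∀ f : C(K, ℝ), (∀ x, 0 ≤ f x) → 0 ≤ φ f) ∧ φ 1 = 1 ∧
      ∀ (g : G) (f : C(K, ℝ)), φ (f.smulComp g) = φ f := by
  set V : Submodule ℝ C(K, ℝ) :=
    Submodule.span ℝ (Set.range fun p : G × C(K, ℝ) => p.2.smulComp p.1 - p.2) with hV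
  set P : Set C(K, ℝ) := {f | ∀ x, 0 < f x} with hP
  have hPopen : IsOpen P := by
    have := ContinuousMap.isOpen_setOfPred_mapsTo (X := K) isCompact_univ
      (isOpen_Ioi : IsOpen (Set.Ioi (0 : ℝ)))
    convert this using 1
    ext f
    simp [hP, Set.MapsTo]
  have hPconv : Convex ℝ P := by
    intro f hf f' hf' a b ha hb hab x
    have h1 := hf x
    have h2 := hf' x
    simp only [ContinuousMap.add_apply, ContinuousMap.smul_apply, smul_eq_mul]
    rcases ha.eq_or_lt with rfl | ha
    · obtain rfl : b = 1 := by linarith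
      simpa using h2
    · nlinarith [mul_pos ha h1, mul_nonneg hb h2.le]
  have hdisj : Disjoint P (V : Set C(K, ℝ)) := by
    rw [Set.disjoint_left]
    intro f hf hfV
    apply h
    -- Dividing a strictly positive element of `V` by its minimum gives a forbidden combination.
    obtain ⟨x₀, -, hx₀⟩ := isCompact_univ.exists_isMinOn (Set.univ_nonempty (α := K))
      f.continuous.continuousOn
    have hx₀' : ∀ x, f x₀ ≤ f x := fun x => hx₀ (Set.mem_univ x)
    obtain ⟨n, c, p, hp⟩ := Submodule.mem_span_set'.1 hfV
    choose q hq using fun i => (p i).2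
    refine ⟨n, fun i => ((f x₀)⁻¹ * c i) • (q i).2, fun i => (q i).1, fun x => ?_⟩
    have hsum : ∑ k, ((((f x₀)⁻¹ * c k) • (q k).2) ((q k).1 • x) -
        (((f x₀)⁻¹ * c k) • (q k).2) x) = (f x₀)⁻¹ * f x := by
      rw [← hp]
      simp only [ContinuousMap.coe_sum, Finset.sum_apply, Finset.mul_sum]
      refine Finset.sum_congr rfl fun k _ => ?_
      rw [← hq k]
      simp only [ContinuousMap.smul_apply, ContinuousMap.sub_apply, smul_eq_mul,
        ContinuousMap.smulComp_apply]
      ring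
    rw [hsum, ← div_eq_inv_mul, one_le_div (hf x₀)]
    exact hx₀' x
  obtain ⟨ψ, c, hψ, hc⟩ := geometric_hahn_banach_open hPconv hPopen V.convex hdisj
  have hc0 : c ≤ 0 := by simpa using hc 0 V.zero_mem
  have hVzero : ∀ f ∈ V, ψ f = 0 := by
    intro f hf
    by_contra hne
    -- The multiple of `f` on which `ψ` would equal `c - 1`, below its lower bound `c` on `V`.
    have := hc (((c - 1) / ψ f) • f) (V.smul_mem _ hf)
    rw [map_smul, smul_eq_mul, div_mul_cancel₀ _ hne] at this
    linarith
  have hneg : ∀ f ∈ P, ψ f < 0 := fun f hf => (hψ f hf).trans_le hc0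
  have hone : ψ 1 < 0 := hneg 1 fun x => by simp
  have hnonpos : ∀ f : C(K, ℝ), (∀ x, 0 ≤ f x) → ψ f ≤ 0 := by
    intro f hf
    refine le_of_forall_pos_le_add fun ε hε => ?_
    have := hneg (f + (ε / (-ψ 1)) • 1) fun x => by
      have h1 := hf x
      have h2 : 0 < ε / (-ψ 1) := div_pos hε (by linarith)
      simp only [ContinuousMap.add_apply, ContinuousMap.smul_apply, ContinuousMap.one_apply,
        smul_eq_mul]
      linarith
    rw [map_add, map_smul, smul_eq_mul, div_neg, neg_mul, div_mul_cancel₀ _ hone.ne] at this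
    linarith
  refine ⟨(ψ 1)⁻¹ • (ψ : C(K, ℝ) →ₗ[ℝ] ℝ), fun f hf => ?_, ?_, fun g f => ?_⟩
  · simpa using mul_nonneg_of_nonpos_of_nonpos (inv_nonpos.2 hone.le) (hnonpos f hf)
  · simpa using inv_mul_cancel₀ hone.ne
  · have := hVzero _ (Submodule.subset_span ⟨(g, f), rfl⟩)
    simp only [map_sub, sub_eq_zero] at this
    simp [this]

/-! ### Poisson transforms and certificates -/

namespace CompactProbAction

variable {G : Type u} [Group G] (A : CompactProbAction G)

instance : Nonempty A.space := nonempty_of_isProbabilityMeasure A.η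

/-- The average of `f` with respect to the translate `g · η`. -/
noncomputable def poisson (f : C(A.space, ℝ)) (g : G) : ℝ :=
  ∫ x, f (g • x) ∂A.η

theorem integral_translate (g : G) (f : C(A.space, ℝ)) :
    ∫ x, f x ∂(A.translate g) = A.poisson f g := by
  rw [translate, poisson, integral_map (continuous_const_smul g).measurable.aemeasurable
    f.continuous.aestronglyMeasurable]

theorem mem_proximalSet {ω : Ultrafilter G} : ω ∈ A.proximalSet ↔
    ∀ (h : G) (f : C(A.space, ℝ)),
      Tendsto (fun g : G => A.poisson f (g * h) - A.poisson f g) (ω : Filter G) (𝓝 0) := by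
  simp [proximalSet, integral_translate]

theorem abs_poisson_le (f : C(A.space, ℝ)) (g : G) : |A.poisson f g| ≤ ‖f‖ := by
  have := norm_integral_le_of_norm_le_const (μ := A.η) (f := fun x => f (g • x)) (C := ‖f‖)
    (ae_of_all _ fun x => f.norm_coe_le_norm _)
  simpa [poisson] using this

theorem poisson_smulComp (s : G) (f : C(A.space, ℝ)) (g : G) :
    A.poisson (f.smulComp s) g = A.poisson f (s * g) := by
  simp [poisson, mul_smul]

/-- The certificate at the points `γ • x`, integrated against `η`. -/
theorem one_le_sum_poisson {κ : Type*} [Fintype κ] {f : κ → C(A.space, ℝ)} {g : κ → G}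
    (h : ∀ x, 1 ≤ ∑ k, (f k (g k • x) - f k x)) (γ : G) :
    1 ≤ ∑ k, (A.poisson (f k) (g k * γ) - A.poisson (f k) γ) :=
  one_le_sum_integral_sub A.η (u := fun k => (f k).smulComp (g k * γ))
    (v := fun k => (f k).smulComp γ) fun x => by simpa [mul_smul] using h (γ • x)

/-- A combination of differences `f (g • x) - f x` bounded below by `1` excludes invariant
probability measures. -/
theorem not_hasInvariantProb_of_le {κ : Type*} [Fintype κ] {f : κ → C(A.space, ℝ)} {g : κ → G}
    (h : ∀ x, 1 ≤ ∑ k, (f k (g k • x) - f k x)) : ¬ A.HasInvariantProb := by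
  rintro ⟨μ, hμ, hinv⟩
  have h1 := one_le_sum_integral_sub μ (u := fun k => (f k).smulComp (g k)) (v := f) h
  have h2 : ∀ k, ∫ x, (f k).smulComp (g k) x ∂μ = ∫ x, f k x ∂μ := fun k =>
    (measurePreserving_smul (g k) μ).integral_comp
      (Homeomorph.smul (g k)).measurableEmbedding _
  simp only [h2, sub_self, Finset.sum_const_zero] at h1
  linarith

theorem exists_le_of_not_hasInvariantProb (h : ¬ A.HasInvariantProb) :
    ∃ (n : ℕ) (f : Fin n → C(A.space, ℝ)) (g : Fin n → G),
      ∀ x, 1 ≤ ∑ k, (f k (g k • x) - f k x) := by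
  by_contra hne
  obtain ⟨φ, hpos, hone, hinv⟩ := exists_invariant_functional hne
  obtain ⟨μ, hμ, hreg, hint⟩ := exists_regular_probability_integral_eq φ hpos hone
  refine h ⟨μ, hμ, ⟨fun g s hs => ?_⟩⟩
  have hmap : μ.map (fun x => g • x) = μ := by
    have : (μ.map (fun x : A.space => g • x)).Regular :=
      Measure.Regular.map (Homeomorph.smul g)
    -- Regularity of both measures makes the integrals of continuous functions determine them.
    refine Measure.ext_of_integral_eq_on_compactlySupported fun f => ?_
    rw [integral_map (f := f) (continuous_const_smul g).measurable.aemeasurable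
      f.continuous.aestronglyMeasurable]
    have := hinv g ⟨f, f.continuous⟩
    rwa [← hint, ← hint] at this
  rw [← Measure.map_apply (continuous_const_smul g).measurable hs, hmap]

/-- Convergence along the principal ultrafilter at `g₀` is equality at `g₀`, so all integrals
against `g₀ · η` would be invariant, against the certificate. -/
theorem proximalSet_subset (h : ¬ A.HasInvariantProb) :
    A.proximalSet ⊆ stoneCechBoundary G := by
  rintro ω hω ⟨g₀, rfl⟩
  rw [mem_proximalSet] at hω
  obtain ⟨n, f, g, hfg⟩ := A.exists_le_of_not_hasInvariantProb h
  have h1 := A.one_le_sum_poisson hfg g₀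
  have h2 : ∀ k, A.poisson (f k) (g k * g₀) - A.poisson (f k) g₀ = 0 := fun k => by
    have := hω (g₀⁻¹ * g k * g₀) (f k)
    rw [Ultrafilter.coe_pure] at this
    have h3 := tendsto_nhds_unique (tendsto_pure_nhds
      (fun s : G => A.poisson (f k) (s * (g₀⁻¹ * g k * g₀)) - A.poisson (f k) s) g₀) this
    simpa [mul_assoc] using h3
  simp only [h2, Finset.sum_const_zero] at h1
  linarith

end CompactProbAction

theorem IsProperlyProximal.of_cover {G : Type u} [Group G] {ι : Type*} [Finite ι] [Nonempty ι]
    (A : ι → CompactProbAction G) (hA : ∀ i, ¬ (A i).HasInvariantProb)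
    (hcover : ∀ ω ∈ stoneCechBoundary G, ∃ i, ω ∈ (A i).proximalSet) :
    IsProperlyProximal G := by
  obtain ⟨n, ⟨e⟩⟩ := Finite.exists_equiv_fin ι
  refine ⟨Fin n, inferInstance, e.symm.nonempty, fun j => A (e.symm j), fun j => hA _, ?_⟩
  refine Set.Subset.antisymm (Set.iUnion_subset fun j => (A _).proximalSet_subset (hA _)) ?_
  intro ω hω
  obtain ⟨i, hi⟩ := hcover ω hω
  exact Set.mem_iUnion.2 ⟨e i, by simpa using hi⟩

/-! ### Nonprincipal ultrafilters -/

section Boundary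

theorem mem_stoneCechBoundary_iff {G : Type*} {ω : Ultrafilter G} :
    ω ∈ stoneCechBoundary G ↔ ∀ g, {g} ∉ ω := by
  constructor
  · intro h g hg
    exact h ⟨g, (Ultrafilter.coe_le_coe.1 (le_pure_iff.2 hg)).symm⟩
  · rintro h ⟨g, rfl⟩
    exact h g (by simp)

theorem le_cofinite_of_mem_stoneCechBoundary {G : Type*} {ω : Ultrafilter G}
    (h : ω ∈ stoneCechBoundary G) : (ω : Filter G) ≤ cofinite := by
  rcases Ultrafilter.le_cofinite_or_eq_pure ω with h' | ⟨g, hg⟩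
  · exact h'
  · exact absurd ⟨g, hg.symm⟩ h

theorem map_mem_stoneCechBoundary {G G' : Type*} {ω : Ultrafilter G} {p : G → G'}
    (h : ω ∈ stoneCechBoundary G) (hp : Function.Injective p) :
    ω.map p ∈ stoneCechBoundary G' := by
  rw [mem_stoneCechBoundary_iff] at h ⊢
  intro g' hg'
  have h1 : p ⁻¹' {g'} ∈ ω := hg'
  obtain ⟨g, hg⟩ := ω.nonempty_of_mem h1
  refine h g (Filter.mem_of_superset h1 fun x hx => hp ?_)
  exact hx.trans hg.symm

/-- If all projections were principal, a finite intersection of cylinders, which is a singleton,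
would lie in `ω`. -/
theorem exists_map_eval_mem_stoneCechBoundary {ι : Type*} [Finite ι] {G : ι → Type*}
    {ω : Ultrafilter (∀ i, G i)} (h : ω ∈ stoneCechBoundary (∀ i, G i)) :
    ∃ i, ω.map (fun g => g i) ∈ stoneCechBoundary (G i) := by
  by_contra! hne
  simp only [mem_stoneCechBoundary_iff, not_forall, not_not] at hne
  choose g hg using hne
  rw [mem_stoneCechBoundary_iff] at h
  refine h g (Filter.mem_of_superset (Filter.iInter_mem.2 fun i => hg i) fun x hx => ?_)
  funext i
  exact Set.mem_iInter.1 hx i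

end Boundary

/-! ### Pulled-back actions and products -/

namespace CompactProbAction

/-- The action of `G'` on the space of `A` through a homomorphism `G' →* G`. -/
noncomputable def pullback {G : Type u} [Group G] (A : CompactProbAction G)
    {G' : Type (max u w)} [Group G'] (φ : G' →* G) : CompactProbAction G' :=
  -- The lift puts the space into the universe of `G'`.
  letI : MeasurableSpace (ULift.{w} A.space) := _root_.borel _
  haveI : BorelSpace (ULift.{w} A.space) := ⟨rfl⟩
  letI act : MulAction G' (ULift.{w} A.space) :=
    { smul := fun g x => ⟨φ g • x.down⟩
      one_smul := fun x => ULift.ext _ _ (by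
        change φ 1 • x.down = x.down
        rw [map_one, one_smul])
      mul_smul := fun g h x => ULift.ext _ _ (by
        change φ (g * h) • x.down = φ g • φ h • x.down
        rw [map_mul, mul_smul]) }
  { space := ULift.{w} A.space
    compact := Homeomorph.ulift.symm.compactSpace
    hausdorff := Homeomorph.ulift.symm.t2Space
    action := act
    continuous_action := ⟨fun g => continuous_uliftUp.comp
      ((continuous_const_smul (φ g)).comp continuous_uliftDown)⟩
    η := A.η.map Homeomorph.ulift.symm
    probability := Measure.isProbabilityMeasure_map
      (Homeomorph.ulift.symm.continuous.measurable.aemeasurable)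
    regular := Measure.Regular.map Homeomorph.ulift.symm }

section Pullback

variable {G : Type u} [Group G] (A : CompactProbAction G) {G' : Type (max u w)} [Group G']
  (φ : G' →* G)

/-- The identification of the space of the pullback with the original space. -/
def pullbackDown : C((A.pullback φ).space, A.space) :=
  (⟨ULift.down, continuous_uliftDown⟩ : C(ULift.{w} A.space, A.space))

/-- The identification of the original space with the space of the pullback. -/
def pullbackUp : C(A.space, (A.pullback φ).space) :=
  (⟨ULift.up, continuous_uliftUp⟩ : C(A.space, ULift.{w} A.space))

theorem pullbackDown_smul (g : G') (x : (A.pullback φ).space) :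
    A.pullbackDown φ (g • x) = φ g • A.pullbackDown φ x :=
  rfl

theorem poisson_pullback (f : C((A.pullback φ).space, ℝ)) (g : G') :
    (A.pullback φ).poisson f g =
      A.poisson (f.comp (A.pullbackUp φ)) (φ g) := by
  have h : (A.pullback φ).η = A.η.map (A.pullbackUp φ) := rfl
  have hm : AEMeasurable (A.pullbackUp φ) A.η := (A.pullbackUp φ).continuous.aemeasurable
  rw [poisson, h]
  refine (integral_map (f := fun x => f (g • x)) hm
    (f.smulComp g).continuous.aestronglyMeasurable).trans ?_
  rfl

theorem mem_proximalSet_pullback {ω : Ultrafilter G'} (h : ω.map φ ∈ A.proximalSet) :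
    ω ∈ (A.pullback φ).proximalSet := by
  rw [mem_proximalSet] at h ⊢
  intro s f
  simp only [poisson_pullback, map_mul]
  exact (h (φ s) _ : Tendsto _ (Filter.map φ ω) _)

/-- Surjectivity allows the group elements of a certificate to be lifted. -/
theorem not_hasInvariantProb_pullback (hφ : Function.Surjective φ) (h : ¬ A.HasInvariantProb) :
    ¬ (A.pullback φ).HasInvariantProb := by
  obtain ⟨n, f, g, hfg⟩ := A.exists_le_of_not_hasInvariantProb h
  choose s hs using fun k => hφ (g k)
  refine (A.pullback φ).not_hasInvariantProb_of_le
    (f := fun k => (f k).comp (A.pullbackDown φ)) (g := s) fun x => ?_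
  simpa [pullbackDown_smul, hs] using hfg (A.pullbackDown φ x)

end Pullback

end CompactProbAction

theorem IsProperlyProximal.pi {ι : Type w} [Finite ι] [Nonempty ι] {G : ι → Type u}
    [∀ i, Group (G i)] (h : ∀ i, IsProperlyProximal (G i)) : IsProperlyProximal (∀ i, G i) := by
  choose κ hfin hne A hA hcover using h
  let B : (Σ i, κ i) → CompactProbAction (∀ i, G i) := fun p =>
    (A p.1 p.2).pullback (Pi.evalMonoidHom G p.1)
  have : Nonempty (Σ i, κ i) := ⟨⟨Classical.arbitrary ι, Classical.arbitrary _⟩⟩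
  refine IsProperlyProximal.of_cover B (fun p => ?_) fun ω hω => ?_
  · exact (A p.1 p.2).not_hasInvariantProb_pullback _ (Function.surjective_eval p.1) (hA p.1 p.2)
  · obtain ⟨i, hi⟩ := exists_map_eval_mem_stoneCechBoundary hω
    rw [← hcover i] at hi
    obtain ⟨j, hj⟩ := Set.mem_iUnion.1 hi
    exact ⟨⟨i, j⟩, (A i j).mem_proximalSet_pullback (Pi.evalMonoidHom G i) hj⟩

/-! ### Co-amenable and finite-index subgroups -/

section Coamenable

/-- A bounded real function, as an element of `ℓ^∞`. -/
def linftyOfBound {X : Type*} (F : X → ℝ) (C : ℝ) (h : ∀ x, |F x| ≤ C) :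
    lp (fun _ : X => ℝ) ∞ :=
  ⟨F, memℓp_infty ⟨C, by rintro _ ⟨x, rfl⟩; exact h x⟩⟩

variable {G : Type u} [Group G]

/-- For `μ` invariant under `H`, the function `s ↦ ∫ x, f (s • x) ∂μ` is right `H`-invariant, so it
descends to `G ⧸ H`, where the mean can be applied to the integrated certificate. -/
theorem CompactProbAction.not_hasInvariantProb_restrict (A : CompactProbAction G)
    (h : ¬ A.HasInvariantProb) {H : Subgroup G} (hH : H.IsCoamenable) :
    ¬ (A.pullback H.subtype).HasInvariantProb := by
  rintro ⟨μ, hμ, hinv⟩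
  obtain ⟨n, f, g, hfg⟩ := A.exists_le_of_not_hasInvariantProb h
  obtain ⟨m, hone, hpos, hm⟩ := hH
  let d : C((A.pullback H.subtype).space, A.space) :=
    A.pullbackDown H.subtype
  let T : C(A.space, ℝ) → G → ℝ := fun f s => ∫ x, f (s • d x) ∂μ
  have hT : ∀ f (s : G) (t : H), T f (s * t) = T f s := fun f s t =>
    Eq.trans (by simp only [T, mul_smul]; rfl)
      ((measurePreserving_smul t μ).integral_comp (Homeomorph.smul t).measurableEmbedding
        fun x => f (s • d x))
  have hTout : ∀ f (s : G), T f (s : G ⧸ H).out = T f s := fun f s => by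
    obtain ⟨t, ht⟩ := QuotientGroup.mk_out_eq_mul H s
    rw [ht, hT]
  have hTb : ∀ f s, |T f s| ≤ ‖f‖ := fun f s => by
    have := norm_integral_le_of_norm_le_const (μ := μ) (f := fun x => f (s • d x)) (C := ‖f‖)
      (ae_of_all _ fun x => f.norm_coe_le_norm _)
    simpa using this
  let F : Fin n → lp (fun _ : G ⧸ H => ℝ) ∞ := fun k =>
    linftyOfBound (fun x => T (f k) x.out) ‖f k‖ fun x => hTb _ _
  -- The mean kills the differences, though the function it is applied to is nonnegative.
  have hzero : m (∑ k, (linftyTranslate (g k)⁻¹ (F k) - F k) - 1) = -1 := by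
    simp [map_sub, map_sum, hm, hone]
  have hnonneg : ∀ x, 0 ≤ (∑ k, (linftyTranslate (g k)⁻¹ (F k) - F k) - 1 :
      lp (fun _ : G ⧸ H => ℝ) ∞) x := by
    intro x
    induction x using QuotientGroup.induction_on with | _ s => ?_
    have h1 := one_le_sum_integral_sub μ
      (u := fun k => ((f k).smulComp (g k * s)).comp d) (v := fun k => ((f k).smulComp s).comp d)
      fun x => by simpa [mul_smul] using hfg (s • d x)
    have h2 : ∀ k, (linftyTranslate (g k)⁻¹ (F k) : G ⧸ H → ℝ) s = T (f k) (g k * s) := fun k => by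
      change T (f k) ((g k)⁻¹⁻¹ • (s : G ⧸ H)).out = _
      rw [inv_inv, ← hTout (f k) (g k * s)]
      rfl
    have h3 : ∀ k, (F k : G ⧸ H → ℝ) s = T (f k) s := fun k => hTout _ _
    rw [lp.coeFn_sub, Pi.sub_apply, lp.coeFn_sum, Finset.sum_apply]
    simp only [lp.coeFn_sub, Pi.sub_apply, h2, h3]
    rw [sub_nonneg]
    exact h1
  have := hpos _ hnonneg
  linarith

theorem IsProperlyProximal.of_isCoamenable {H : Subgroup G} (h : IsProperlyProximal G)
    (hH : H.IsCoamenable) : IsProperlyProximal H := by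
  obtain ⟨ι, hfin, hne, A, hA, hcover⟩ := h
  refine IsProperlyProximal.of_cover (fun i => (A i).pullback H.subtype)
    (fun i => (A i).not_hasInvariantProb_restrict (hA i) hH) fun ω hω => ?_
  have h1 := map_mem_stoneCechBoundary hω H.subtype_injective
  rw [← hcover] at h1
  obtain ⟨i, hi⟩ := Set.mem_iUnion.1 h1
  exact ⟨i, (A i).mem_proximalSet_pullback H.subtype hi⟩

theorem Subgroup.isCoamenable_of_finiteIndex (H : Subgroup G) (hH : H.FiniteIndex) :
    H.IsCoamenable := by
  have : Fintype (G ⧸ H) := Fintype.ofFinite _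
  have hc : (Fintype.card (G ⧸ H) : ℝ) ≠ 0 := by simp
  refine ⟨{ toFun := fun f => (Fintype.card (G ⧸ H) : ℝ)⁻¹ * ∑ x, f x
            map_add' := fun f f' => ?_
            map_smul' := fun c f => ?_ }, ?_, fun f hf => ?_, fun g f => ?_⟩
  · simp only [lp.coeFn_add, Pi.add_apply, Finset.sum_add_distrib, mul_add]
  · simp [← Finset.mul_sum, mul_left_comm]
  · simp [hc]
  · exact mul_nonneg (by positivity) (Finset.sum_nonneg fun x _ => hf x)
  · exact congrArg ((Fintype.card (G ⧸ H) : ℝ)⁻¹ * ·)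
      (Equiv.sum_comp (MulAction.toPerm g⁻¹) fun x : G ⧸ H => f x)

end Coamenable

/-! ### Asymptotic paradoxes under finite kernels and finite index -/

theorem tendsto_cofinite_of_finite_fibers {α β : Type*} {p : α → β}
    (h : ∀ b, (p ⁻¹' {b}).Finite) : Tendsto p cofinite cofinite := by
  intro s hs
  rw [mem_map, mem_cofinite, ← Set.preimage_compl]
  exact (mem_cofinite.1 hs).preimage' fun b _ => h b

theorem infinite_of_tendsto_cofinite {α β : Type*} [Infinite α] {p : α → β}
    (h : Tendsto p cofinite cofinite) : Infinite β := by
  by_contra hβ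
  rw [not_infinite_iff_finite] at hβ
  exact (h.neBot (x := cofinite)).ne cofinite_eq_bot

/-- An infinite group `G` has an asymptotic paradox if, for some fixed finite family of left
translations and some uniform bound, there are families of bounded functions which are as right
invariant as desired and for which the sum of the differences with the left translates is at least
`1` outside of a finite set. -/
def HasAsymptoticParadox (G : Type*) [Group G] : Prop :=
  Infinite G ∧ ∃ (κ : Type) (_ : Fintype κ) (g : κ → G) (C : ℝ),
    ∀ F : Set G, F.Finite → ∀ ε : ℝ, 0 < ε → ∃ b : κ → G → ℝ,
      (∀ k x, |b k x| ≤ C) ∧ (∀ k, ∀ h ∈ F, ∀ x, |b k (x * h) - b k x| ≤ ε) ∧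
      ∀ᶠ x in cofinite, 1 ≤ ∑ k, (b k (g k * x) - b k x)

namespace HasAsymptoticParadox

theorem comap {Γ Q : Type*} [Group Γ] [Group Q] (φ : Γ →* Q) (hφ : Function.Surjective φ)
    (hker : (φ.ker : Set Γ).Finite) (h : HasAsymptoticParadox Q) : HasAsymptoticParadox Γ := by
  obtain ⟨hinf, κ, _, g, C, hb⟩ := h
  choose s hs using fun k => hφ (g k)
  have htend : Tendsto φ cofinite cofinite := tendsto_cofinite_of_finite_fibers fun q => by
    obtain ⟨x, rfl⟩ := hφ q
    refine (hker.image (x * ·)).subset fun y hy => ⟨x⁻¹ * y, ?_, by simp⟩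
    have hy' : φ y = φ x := hy
    simp [MonoidHom.mem_ker, hy']
  refine ⟨Infinite.of_surjective φ hφ, κ, inferInstance, s, C, fun F hF ε hε => ?_⟩
  obtain ⟨b, hC, hinv, hpar⟩ := hb (φ '' F) (hF.image φ) ε hε
  refine ⟨fun k x => b k (φ x), fun k x => hC k _, fun k h hh x => ?_, ?_⟩
  · simpa using hinv k (φ h) ⟨h, hh, rfl⟩ (φ x)
  · filter_upwards [htend.eventually hpar] with x hx
    simpa [hs] using hx

/-- The functions are averaged over the finite kernel. The average depends only on the image in `Q`,
so a set-theoretic section `σ` suffices. -/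
theorem map {Γ Q : Type*} [Group Γ] [Group Q] (φ : Γ →* Q) (hφ : Function.Surjective φ)
    (hker : (φ.ker : Set Γ).Finite) (h : HasAsymptoticParadox Γ) : HasAsymptoticParadox Q := by
  obtain ⟨hinf, κ, _, g, C, hb⟩ := h
  choose σ hσ using hφ
  have : Fintype φ.ker := hker.fintype
  have htend : Tendsto φ cofinite cofinite := tendsto_cofinite_of_finite_fibers fun q => by
    refine (hker.image (σ q * ·)).subset fun y hy => ⟨(σ q)⁻¹ * y, ?_, by simp⟩
    have hy' : φ y = q := hy
    simp [MonoidHom.mem_ker, hy', hσ]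
  let c : ℝ := Fintype.card φ.ker
  have hc : 0 < c := Nat.cast_pos.2 Fintype.card_pos
  refine ⟨infinite_of_tendsto_cofinite htend, κ, inferInstance, fun k => φ (g k), C,
    fun F hF ε hε => ?_⟩
  obtain ⟨b, hC, hinv, hpar⟩ := hb (σ '' F) (hF.image σ) ε hε
  have hS : ∀ k x y, φ x = φ y → ∑ n : φ.ker, b k (n * x) = ∑ n : φ.ker, b k (n * y) := by
    intro k x y hxy
    have hm : x * y⁻¹ ∈ φ.ker := by simp [MonoidHom.mem_ker, hxy]
    rw [← Equiv.sum_comp (Equiv.mulRight (⟨x * y⁻¹, hm⟩ : φ.ker))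
      fun n : φ.ker => b k (n * y)]
    exact Finset.sum_congr rfl fun n _ => by simp [mul_assoc]
  -- Normality: conjugation by `s` permutes the kernel.
  have hS' : ∀ k s x, ∑ n : φ.ker, b k (n * (s * x)) = ∑ n : φ.ker, b k (s * (n * x)) := by
    intro k s x
    rw [← Equiv.sum_comp (MulAut.conjNormal s : φ.ker ≃* φ.ker).toEquiv
      fun n : φ.ker => b k (n * (s * x))]
    exact Finset.sum_congr rfl fun n _ => by simp [mul_assoc]
  refine ⟨fun k q => c⁻¹ * ∑ n : φ.ker, b k (n * σ q), fun k q => ?_, fun k h hh q => ?_, ?_⟩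
  · rw [abs_mul, abs_of_pos (inv_pos.2 hc), inv_mul_le_iff₀ hc]
    refine (Finset.abs_sum_le_sum_abs _ _).trans ((Finset.sum_le_sum fun n _ => hC k _).trans ?_)
    simp [c]
  · beta_reduce
    rw [hS k (σ (q * h)) (σ q * σ h) (by simp [hσ]), ← mul_sub, ← Finset.sum_sub_distrib, abs_mul,
      abs_of_pos (inv_pos.2 hc), inv_mul_le_iff₀ hc]
    refine (Finset.abs_sum_le_sum_abs _ _).trans ((Finset.sum_le_sum (g := fun _ => ε)
      fun n _ => ?_).trans ?_)
    · simpa [mul_assoc] using hinv k (σ h) ⟨h, hh, rfl⟩ (n * σ q)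
    · simp [c]
  · have hall : ∀ n : φ.ker, ∀ᶠ q in cofinite,
        1 ≤ ∑ k, (b k (g k * (n * σ q)) - b k (n * σ q)) := fun n => by
      refine (Function.Injective.tendsto_cofinite (f := fun q => (n : Γ) * σ q) ?_).eventually hpar
      exact (mul_right_injective _).comp (Function.LeftInverse.injective hσ)
    filter_upwards [eventually_all.2 hall] with q hq
    have h1 : ∀ k, c⁻¹ * ∑ n : φ.ker, b k (n * σ (φ (g k) * q)) -
        c⁻¹ * ∑ n : φ.ker, b k (n * σ q) =
        c⁻¹ * ∑ n : φ.ker, (b k (g k * (n * σ q)) - b k (n * σ q)) := fun k => by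
      rw [hS k (σ (φ (g k) * q)) (g k * σ q) (by simp [hσ]), hS', Finset.sum_sub_distrib, mul_sub]
    simp only [h1]
    rw [← Finset.mul_sum, Finset.sum_comm, le_inv_mul_iff₀ hc, mul_one]
    calc c = ∑ n : φ.ker, (1 : ℝ) := by simp [c]
      _ ≤ _ := Finset.sum_le_sum fun n _ => hq n

/-- Composition with a left `H`-equivariant retraction `r x = x * q x` onto `H` with finite fibres,
where `q x` represents the coset of `x⁻¹`. Right multiplication of `x` by `t` multiplies `r x` on
the right by `(q x)⁻¹ * t * q (x * t)`, which takes finitely many values. -/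
theorem of_finiteIndex {G : Type*} [Group G] {H : Subgroup G} (hH : H.FiniteIndex)
    (h : HasAsymptoticParadox H) : HasAsymptoticParadox G := by
  obtain ⟨hinf, κ, _, g, C, hb⟩ := h
  let q : G → G := fun x => ((x⁻¹ : G) : G ⧸ H).out
  have hq : ∀ x, x * q x ∈ H := fun x => by
    have := QuotientGroup.eq.1 (QuotientGroup.out_eq' ((x⁻¹ : G) : G ⧸ H)).symm
    simpa using this
  let r : G → H := fun x => ⟨x * q x, hq x⟩
  have hqH : ∀ (s : H) x, q (s * x) = q x := fun s x => by
    have : (((s * x : G)⁻¹ : G) : G ⧸ H) = ((x⁻¹ : G) : G ⧸ H) := by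
      rw [QuotientGroup.eq]; simp
    simp only [q, this]
  have hr : ∀ (s : H) x, r (s * x) = s * r x := fun s x => Subtype.ext (by
    simp [r, hqH, mul_assoc])
  have htend : Tendsto r cofinite cofinite := tendsto_cofinite_of_finite_fibers fun s => by
    refine (Set.finite_range fun a : G ⧸ H => (s : G) * a.out⁻¹).subset fun x hx => ?_
    have hx' : x * q x = s := congrArg Subtype.val (hx : r x = s)
    exact ⟨((x⁻¹ : G) : G ⧸ H), by simp [← hx', q]⟩
  refine ⟨Infinite.of_injective _ H.subtype_injective, κ, inferInstance, fun k => g k, C,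
    fun F hF ε hε => ?_⟩
  let F' : Set H := {s | ∃ a b : G ⧸ H, ∃ k ∈ F, a.out⁻¹ * k * b.out = (s : G)}
  have hF' : F'.Finite := by
    refine Set.Finite.of_finite_image (f := Subtype.val)
      (((Set.finite_univ (α := (G ⧸ H) × (G ⧸ H))).prod hF).image
        (fun p => p.1.1.out⁻¹ * p.2 * p.1.2.out) |>.subset ?_) Subtype.val_injective.injOn
    rintro _ ⟨s, ⟨a, b, k, hk, hs⟩, rfl⟩
    exact ⟨⟨(a, b), k⟩, ⟨Set.mem_univ _, hk⟩, hs⟩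
  obtain ⟨b, hC, hinv, hpar⟩ := hb F' hF' ε hε
  refine ⟨fun k x => b k (r x), fun k x => hC k _, fun k t ht x => ?_, ?_⟩
  · have hmem : (q x)⁻¹ * t * q (x * t) ∈ H := by
      have := H.mul_mem (H.inv_mem (hq x)) (hq (x * t))
      simpa [mul_assoc] using this
    have hrt : r (x * t) = r x * ⟨(q x)⁻¹ * t * q (x * t), hmem⟩ := Subtype.ext (by
      simp [r, mul_assoc])
    beta_reduce
    rw [hrt]
    exact hinv k _ ⟨_, _, t, ht, rfl⟩ _
  · filter_upwards [htend.eventually hpar] with x hx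
    simpa [hr] using hx

end HasAsymptoticParadox

/-! ### From proximal actions to asymptotic paradoxes -/

/-- A set in a filter supports a function which equals one along the filter and varies slowly under
finitely many permutations preserving the filter. -/
theorem exists_slowly_varying_cutoff {α : Type*} {𝓕 : Filter α} {T : Set (Equiv.Perm α)}
    (hT : T.Finite) (hτ : ∀ τ ∈ T, Tendsto τ 𝓕 𝓕 ∧ Tendsto τ.symm 𝓕 𝓕) {A : Set α} (hA : A ∈ 𝓕)
    {δ : ℝ} (hδ : 0 < δ) :
    ∃ θ : α → ℝ, (∀ x, 0 ≤ θ x) ∧ (∀ x, θ x ≤ 1) ∧ (∀ x ∉ A, θ x = 0) ∧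
      (∀ᶠ x in 𝓕, θ x = 1) ∧ ∀ τ ∈ T, ∀ x, |θ (τ x) - θ x| ≤ δ := by
  classical
  obtain ⟨n, hn⟩ := exists_nat_one_div_lt hδ
  -- Nested sets, each moved into its predecessor by every `τ ∈ T` and its inverse. The cutoff
  -- averages the indicators of `n + 1` of them; a permutation shifts the depth by at most one,
  -- changing the average by at most `1 / (n + 1)`.
  obtain ⟨B, hBzero, hBsucc⟩ : ∃ B : ℕ → Set α, B 0 = A ∧
      ∀ j, B (j + 1) = B j ∩ {x | ∀ τ ∈ T, τ x ∈ B j ∧ τ.symm x ∈ B j} :=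
    ⟨fun j => Nat.rec A (fun _ s => s ∩ {x | ∀ τ ∈ T, τ x ∈ s ∧ τ.symm x ∈ s}) j, rfl,
      fun _ => rfl⟩
  have hBmem : ∀ j, B j ∈ 𝓕 := by
    intro j
    induction j with
    | zero => exact hBzero ▸ hA
    | succ j ih =>
      rw [hBsucc]
      refine inter_mem ih ((eventually_all_finite hT).2 fun τ h => ?_)
      exact ((hτ τ h).1.eventually ih).and ((hτ τ h).2.eventually ih)
  have hBA : ∀ j, B j ⊆ A := by
    intro j
    induction j with
    | zero => exact hBzero.subset
    | succ j ih => exact (hBsucc j ▸ Set.inter_subset_left).trans ih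
  have hpos : (0 : ℝ) < n + 1 := by positivity
  let θ : α → ℝ := fun x =>
    ((Finset.range (n + 1)).sum fun j : ℕ => if x ∈ B j then (1 : ℝ) else 0) / (n + 1)
  have hstep : ∀ x y, (∀ j, x ∈ B (j + 1) → y ∈ B j) → θ x - θ y ≤ δ := by
    intro x y hxy
    refine le_trans ?_ hn.le
    rw [← sub_div]
    refine div_le_div_of_nonneg_right ?_ hpos.le
    rw [Finset.sum_range_succ', Finset.sum_range_succ]
    have h1 : ∑ j ∈ Finset.range n, (if x ∈ B (j + 1) then (1 : ℝ) else 0) ≤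
        ∑ j ∈ Finset.range n, (if y ∈ B j then (1 : ℝ) else 0) := by
      refine Finset.sum_le_sum fun j _ => ?_
      split_ifs with h h' h'
      · exact le_rfl
      · exact absurd (hxy j h) h'
      · exact zero_le_one
      · exact le_rfl
    have h2 : (if x ∈ B 0 then (1 : ℝ) else 0) ≤ 1 := by split_ifs <;> norm_num
    have h3 : (0 : ℝ) ≤ (if y ∈ B n then (1 : ℝ) else 0) := by split_ifs <;> norm_num
    linarith
  refine ⟨θ, fun x => ?_, fun x => ?_, fun x hx => ?_, ?_, fun τ h x => ?_⟩
  · exact div_nonneg (Finset.sum_nonneg fun j _ => by split_ifs <;> norm_num) hpos.le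
  · rw [div_le_one hpos]
    refine (Finset.sum_le_sum (g := fun _ => (1 : ℝ)) fun j _ => ?_).trans (by simp)
    split_ifs <;> norm_num
  · have : ∀ j, x ∉ B j := fun j hj => hx (hBA j hj)
    simp [θ, this]
  · have : ∀ᶠ x in 𝓕, ∀ j ∈ Finset.range (n + 1), x ∈ B j :=
      (Finset.eventually_all _).2 fun j _ => hBmem j
    filter_upwards [this] with x hx
    simp only [θ]
    rw [Finset.sum_congr rfl fun j hj => if_pos (hx j hj)]
    simp [hpos.ne']
  · rw [abs_sub_le_iff]
    refine ⟨hstep _ _ fun j hj => ?_, hstep _ _ fun j hj => ?_⟩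
    · rw [hBsucc] at hj
      simpa using (hj.2 τ h).2
    · rw [hBsucc] at hj
      exact (hj.2 τ h).1

namespace CompactProbAction

variable {G : Type u} [Group G] (A : CompactProbAction G)

theorem map_mul_left_mem_proximalSet {ω : Ultrafilter G} (h : ω ∈ A.proximalSet) (s : G) :
    ω.map (s * ·) ∈ A.proximalSet := by
  rw [mem_proximalSet] at h ⊢
  intro t f
  have := h t (f.smulComp s)
  simp only [poisson_smulComp] at this
  refine tendsto_map'_iff.2 ?_
  simpa [Function.comp_def, mul_assoc] using this

/-- The difference between `g * s * t` and `g * s` is the difference of two comparisons with `g`. -/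
theorem map_mul_right_mem_proximalSet {ω : Ultrafilter G} (h : ω ∈ A.proximalSet) (s : G) :
    ω.map (· * s) ∈ A.proximalSet := by
  rw [mem_proximalSet] at h ⊢
  intro t f
  refine tendsto_map'_iff.2 ?_
  simpa [Function.comp_def, mul_assoc] using (h (s * t) f).sub (h s f)

/-- The filter of neighbourhoods in `G` of the set of proximal elements. -/
def proximalFilter : Filter G :=
  ⨆ ω ∈ A.proximalSet, (ω : Filter G)

theorem tendsto_proximalFilter {G' : Type*} {p : G → G'} {l : Filter G'} :
    Tendsto p A.proximalFilter l ↔ ∀ ω ∈ A.proximalSet, Tendsto p (ω : Filter G) l := by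
  simp [proximalFilter, tendsto_iSup]

theorem le_proximalFilter {ω : Ultrafilter G} (h : ω ∈ A.proximalSet) :
    (ω : Filter G) ≤ A.proximalFilter :=
  le_iSup₂_of_le ω h le_rfl

theorem tendsto_mul_left_proximalFilter (s : G) :
    Tendsto (s * ·) A.proximalFilter A.proximalFilter :=
  A.tendsto_proximalFilter.2 fun _ h => A.le_proximalFilter (A.map_mul_left_mem_proximalSet h s)

theorem tendsto_mul_right_proximalFilter (s : G) :
    Tendsto (· * s) A.proximalFilter A.proximalFilter :=
  A.tendsto_proximalFilter.2 fun _ h => A.le_proximalFilter (A.map_mul_right_mem_proximalSet h s)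

theorem tendsto_poisson_sub (h : G) (f : C(A.space, ℝ)) :
    Tendsto (fun g => A.poisson f (g * h) - A.poisson f g) A.proximalFilter (𝓝 0) :=
  A.tendsto_proximalFilter.2 fun _ hω => A.mem_proximalSet.1 hω h f

/-- Over a finite group, the sum of the certificate inequality telescopes to zero. -/
theorem infinite_of_not_hasInvariantProb (h : ¬ A.HasInvariantProb) : Infinite G := by
  by_contra hG
  rw [not_infinite_iff_finite] at hG
  have := Fintype.ofFinite G
  obtain ⟨n, f, g, hfg⟩ := A.exists_le_of_not_hasInvariantProb h
  have h1 : ∑ x : G, (1 : ℝ) ≤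
      ∑ x : G, ∑ k, (A.poisson (f k) (g k * x) - A.poisson (f k) x) :=
    Finset.sum_le_sum fun x _ => A.one_le_sum_poisson hfg x
  have h2 : ∀ k, ∑ x : G, (A.poisson (f k) (g k * x) - A.poisson (f k) x) = 0 := fun k => by
    rw [Finset.sum_sub_distrib, sub_eq_zero]
    exact Equiv.sum_comp (Equiv.mulLeft (g k)) fun x => A.poisson (f k) x
  rw [Finset.sum_comm, Finset.sum_eq_zero fun k _ => h2 k] at h1
  have : (0 : ℝ) < Fintype.card G := Nat.cast_pos.2 Fintype.card_pos
  simp only [Finset.sum_const, Finset.card_univ, nsmul_eq_mul, mul_one] at h1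
  linarith

end CompactProbAction

theorem IsProperlyProximal.hasAsymptoticParadox {G : Type u} [Group G]
    (h : IsProperlyProximal G) : HasAsymptoticParadox G := by
  obtain ⟨ι, hfin, hne, A, hA, hcover⟩ := h
  have := Fintype.ofFinite ι
  choose n f g hfg using fun i => (A i).exists_le_of_not_hasInvariantProb (hA i)
  -- The factor `2` leaves room for a total cutoff error of `1`.
  let c : (Σ i, Fin (n i)) → G → ℝ := fun p x => 2 * (A p.1).poisson (f p.1 p.2) x
  let C : ℝ := 1 + ∑ p : Σ i, Fin (n i), 2 * ‖f p.1 p.2‖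
  have hC : 0 < C := by positivity
  have hcC : ∀ p x, |c p x| ≤ C := fun p x => by
    have h1 : 2 * ‖f p.1 p.2‖ ≤ ∑ p : Σ i, Fin (n i), 2 * ‖f p.1 p.2‖ :=
      Finset.single_le_sum (f := fun p : Σ i, Fin (n i) => 2 * ‖f p.1 p.2‖)
        (fun p _ => by positivity) (Finset.mem_univ p)
    have h2 := (A p.1).abs_poisson_le (f p.1 p.2) x
    simp only [c, abs_mul, abs_two, C]
    linarith
  have hc2 : ∀ i x, 2 ≤ ∑ k, (c ⟨i, k⟩ (g i k * x) - c ⟨i, k⟩ x) := fun i x => by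
    have := (A i).one_le_sum_poisson (hfg i) x
    simp only [c, ← mul_sub, ← Finset.mul_sum]
    linarith
  refine ⟨(A (Classical.arbitrary ι)).infinite_of_not_hasInvariantProb (hA _),
    Σ i, Fin (n i), inferInstance, fun p => g p.1 p.2, C, fun F hF ε hε => ?_⟩
  let N : ℝ := Fintype.card (Σ i, Fin (n i))
  have hN : 0 ≤ N := Nat.cast_nonneg _
  -- The first bound controls right invariance, the second the summed error from left translation of
  -- the cutoffs.
  let δ : ℝ := min (ε / 2 / C) (1 / (N + 1) / C)
  have hδ : 0 < δ := lt_min (by positivity) (by positivity)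
  have hδε : δ * C ≤ ε / 2 := (le_div_iff₀ hC).1 (min_le_left _ _)
  have hδN : N * (δ * C) ≤ 1 := by
    have h1 : δ * C ≤ 1 / (N + 1) := (le_div_iff₀ hC).1 (min_le_right _ _)
    calc N * (δ * C) ≤ N * (1 / (N + 1)) := mul_le_mul_of_nonneg_left h1 hN
      _ ≤ 1 := by rw [mul_one_div, div_le_one (by positivity)]; linarith
  let B : ι → Set G := fun i => {x | ∀ k, ∀ h ∈ F, |c ⟨i, k⟩ (x * h) - c ⟨i, k⟩ x| ≤ ε / 2}
  have hB : ∀ i, B i ∈ (A i).proximalFilter := fun i => by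
    refine eventually_all.2 fun k => (eventually_all_finite hF).2 fun h _ => ?_
    have h1 := ((A i).tendsto_poisson_sub h (f i k)).const_mul 2
    rw [mul_zero] at h1
    filter_upwards [Metric.tendsto_nhds.1 h1 (ε / 2) (by positivity)] with x hx
    rw [Real.dist_0_eq_abs, mul_sub] at hx
    exact hx.le
  let T : ι → Set (Equiv.Perm G) := fun i =>
    Set.range (fun k => Equiv.mulLeft (g i k)) ∪ Equiv.mulRight '' F
  have hT : ∀ i, (T i).Finite := fun i => (Set.finite_range _).union (hF.image _)
  have hTτ : ∀ i, ∀ τ ∈ T i, Tendsto τ (A i).proximalFilter (A i).proximalFilter ∧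
      Tendsto τ.symm (A i).proximalFilter (A i).proximalFilter := by
    rintro i _ (⟨k, rfl⟩ | ⟨s, -, rfl⟩)
    · exact ⟨(A i).tendsto_mul_left_proximalFilter _, (A i).tendsto_mul_left_proximalFilter _⟩
    · exact ⟨(A i).tendsto_mul_right_proximalFilter _, (A i).tendsto_mul_right_proximalFilter _⟩
  choose θ h0 h1 hsupp hone hslow using fun i =>
    exists_slowly_varying_cutoff (hT i) (hTτ i) (hB i) hδ
  refine ⟨fun p x => θ p.1 x * c p x, fun p x => ?_, fun p h hh x => ?_, ?_⟩
  · rw [abs_mul, abs_of_nonneg (h0 _ _)]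
    exact (mul_le_of_le_one_left (abs_nonneg _) (h1 _ _)).trans (hcC p x)
  · have e : θ p.1 (x * h) * c p (x * h) - θ p.1 x * c p x =
        (θ p.1 (x * h) - θ p.1 x) * c p (x * h) + θ p.1 x * (c p (x * h) - c p x) := by ring
    have e1 : |(θ p.1 (x * h) - θ p.1 x) * c p (x * h)| ≤ δ * C := by
      rw [abs_mul]
      exact mul_le_mul (hslow p.1 (Equiv.mulRight h) (Or.inr ⟨h, hh, rfl⟩) x) (hcC _ _)
        (abs_nonneg _) hδ.le
    have e2 : |θ p.1 x * (c p (x * h) - c p x)| ≤ ε / 2 := by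
      by_cases hx : x ∈ B p.1
      · rw [abs_mul, abs_of_nonneg (h0 _ _)]
        exact (mul_le_of_le_one_left (abs_nonneg _) (h1 _ _)).trans (hx p.2 h hh)
      · rw [hsupp _ x hx, zero_mul, abs_zero]
        positivity
    rw [e]
    exact (abs_add_le _ _).trans (by linarith)
  · have hcov : ∀ᶠ x in cofinite, ∃ i, θ i x = 1 := by
      -- A set lying in every nonprincipal ultrafilter is cofinite; each such ultrafilter is
      -- proximal for some `i`.
      refine mem_iff_ultrafilter.2 fun ω hω => ?_
      have hmem : ω ∈ stoneCechBoundary G := mem_stoneCechBoundary_iff.2 fun s hs =>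
        ω.compl_notMem_iff.2 hs (hω (Set.finite_singleton s).compl_mem_cofinite)
      rw [← hcover] at hmem
      obtain ⟨i, hi⟩ := Set.mem_iUnion.1 hmem
      filter_upwards [(A i).le_proximalFilter hi (hone i)] with x hx using ⟨i, hx⟩
    filter_upwards [hcov] with x hx
    obtain ⟨i₀, hi₀⟩ := hx
    have e : ∀ p : Σ i, Fin (n i), θ p.1 x * (c p (g p.1 p.2 * x) - c p x) - δ * C ≤
        θ p.1 (g p.1 p.2 * x) * c p (g p.1 p.2 * x) - θ p.1 x * c p x := fun p => by
      have e1 : |(θ p.1 (g p.1 p.2 * x) - θ p.1 x) * c p (g p.1 p.2 * x)| ≤ δ * C := by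
        rw [abs_mul]
        exact mul_le_mul (hslow p.1 (Equiv.mulLeft _) (Or.inl ⟨p.2, rfl⟩) x) (hcC _ _)
          (abs_nonneg _) hδ.le
      have := (abs_le.1 e1).1
      linarith
    refine le_trans ?_ (Finset.sum_le_sum fun p _ => e p)
    rw [Finset.sum_sub_distrib, Finset.sum_const, nsmul_eq_mul, Finset.card_univ,
      Fintype.sum_sigma]
    have e3 : ∀ i, 2 * θ i x ≤ ∑ k, θ i x * (c ⟨i, k⟩ (g i k * x) - c ⟨i, k⟩ x) := fun i => by
      rw [← Finset.mul_sum, mul_comm]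
      exact mul_le_mul_of_nonneg_left (hc2 i x) (h0 i x)
    have e4 : 2 * θ i₀ x ≤ ∑ i, 2 * θ i x :=
      Finset.single_le_sum (f := fun i => 2 * θ i x) (fun i _ => by have := h0 i x; positivity)
        (Finset.mem_univ i₀)
    have e5 := Finset.sum_le_sum fun i (_ : i ∈ Finset.univ) => e3 i
    rw [hi₀] at e4
    simp only at e5 ⊢
    linarith

/-! ### Diagonal averaging in a countable group -/

/-- A countable group carries a proper function to `ℕ` which is small on prescribed finite sets, and
which asymptotically changes by at most one under each left or right translation. -/
theorem exists_level_function {G : Type*} [Group G] [Countable G] {X : ℕ → Set G}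
    (hX : ∀ n, (X n).Finite) :
    ∃ l : G → ℕ, Tendsto l cofinite atTop ∧ (∀ n, ∀ x ∈ X n, l x ≤ n) ∧
      ∀ h, (∀ᶠ x in cofinite, l (h * x) ≤ l x + 1 ∧ l x ≤ l (h * x) + 1) ∧
        ∀ᶠ x in cofinite, l (x * h) ≤ l x + 1 ∧ l x ≤ l (x * h) + 1 := by
  obtain ⟨e, he⟩ := exists_surjective_nat G
  -- An exhaustion by finite sets in which translates of `L n` by `e j`, `j ≤ n`, lie in `L (n +
  -- 1)`; the level of `x` is the first `n` with `x ∈ L n`.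
  let L : ℕ → Set G := fun n => Nat.rec (X 0 ∪ {e 0}) (fun n s => s ∪ (X (n + 1) ∪ {e (n + 1)}) ∪
    ⋃ j ∈ Set.Iic n, ((e j * ·) '' s ∪ (· * e j) '' s)) n
  have hLsucc : ∀ n, L (n + 1) = L n ∪ (X (n + 1) ∪ {e (n + 1)}) ∪
    ⋃ j ∈ Set.Iic n, ((e j * ·) '' L n ∪ (· * e j) '' L n) := fun _ => rfl
  have hfin : ∀ n, (L n).Finite := by
    intro n
    induction n with
    | zero => exact (hX 0).union (Set.finite_singleton _)
    | succ n ih =>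
      rw [hLsucc]
      exact (ih.union ((hX _).union (Set.finite_singleton _))).union
        ((Set.finite_Iic n).biUnion fun j _ => (ih.image _).union (ih.image _))
  have hmono : Monotone L := monotone_nat_of_le_succ fun n => by
    rw [hLsucc]
    exact Set.subset_union_left.trans Set.subset_union_left
  have hXL : ∀ n, X n ∪ {e n} ⊆ L n := by
    intro n
    cases n with
    | zero => exact subset_rfl
    | succ n =>
      rw [hLsucc]
      exact Set.subset_union_right.trans Set.subset_union_left
  have hex : ∀ x, ∃ n, x ∈ L n := fun x => by
    obtain ⟨n, rfl⟩ := he x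
    exact ⟨n, hXL n (Or.inr rfl)⟩
  let l : G → ℕ := fun x => sInf {n | x ∈ L n}
  have hl : ∀ x, x ∈ L (l x) := fun x => Nat.sInf_mem (hex x)
  have hle : ∀ {x n}, x ∈ L n → l x ≤ n := fun hx => Nat.sInf_le hx
  have htend : Tendsto l cofinite atTop := by
    refine tendsto_atTop.2 fun n => ?_
    refine mem_cofinite.2 ((hfin n).subset fun x hx => ?_)
    exact hmono (not_le.1 (show ¬ n ≤ l x from hx)).le (hl x)
  have hleft : ∀ h, ∀ᶠ x in cofinite, l (h * x) ≤ l x + 1 := fun h => by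
    obtain ⟨j, rfl⟩ := he h
    filter_upwards [htend.eventually_ge_atTop j] with x hx
    refine hle ?_
    rw [hLsucc]
    exact Or.inr (Set.mem_biUnion (Set.mem_Iic.2 hx) (Or.inl ⟨x, hl x, rfl⟩))
  have hright : ∀ h, ∀ᶠ x in cofinite, l (x * h) ≤ l x + 1 := fun h => by
    obtain ⟨j, rfl⟩ := he h
    filter_upwards [htend.eventually_ge_atTop j] with x hx
    refine hle ?_
    rw [hLsucc]
    exact Or.inr (Set.mem_biUnion (Set.mem_Iic.2 hx) (Or.inr ⟨x, hl x, rfl⟩))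
  refine ⟨l, htend, fun n x hx => hle (hXL n (Or.inl hx)), fun h => ⟨?_, ?_⟩⟩
  · filter_upwards [hleft h,
      (mul_right_injective h).tendsto_cofinite.eventually (hleft h⁻¹)] with x h1 h2
    exact ⟨h1, by simpa using h2⟩
  · filter_upwards [hright h,
      (mul_left_injective h).tendsto_cofinite.eventually (hright h⁻¹)] with x h1 h2
    exact ⟨h1, by simpa using h2⟩

/-- The average of the first `n` terms of a sequence. -/
noncomputable def cesaroMean (u : ℕ → ℝ) (n : ℕ) : ℝ :=
  (n : ℝ)⁻¹ * ∑ i ∈ Finset.range n, u i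

theorem cesaroMean_sub (u v : ℕ → ℝ) (n : ℕ) :
    cesaroMean (fun i => u i - v i) n = cesaroMean u n - cesaroMean v n := by
  simp [cesaroMean, Finset.sum_sub_distrib, mul_sub]

theorem cesaroMean_sum {κ : Type*} [Fintype κ] (u : κ → ℕ → ℝ) (n : ℕ) :
    cesaroMean (fun i => ∑ k, u k i) n = ∑ k, cesaroMean (u k) n := by
  simp only [cesaroMean, ← Finset.mul_sum]
  rw [Finset.sum_comm]

theorem le_cesaroMean {u : ℕ → ℝ} {c : ℝ} {n : ℕ} (hn : 0 < n) (h : ∀ i < n, c ≤ u i) :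
    c ≤ cesaroMean u n := by
  have hn' : (0 : ℝ) < n := Nat.cast_pos.2 hn
  rw [cesaroMean, le_inv_mul_iff₀ hn']
  calc (n : ℝ) * c = ∑ i ∈ Finset.range n, c := by simp
    _ ≤ _ := Finset.sum_le_sum fun i hi => h i (Finset.mem_range.1 hi)

theorem abs_cesaroMean_le {u v : ℕ → ℝ} (h : ∀ i, |u i| ≤ v i) (n : ℕ) :
    |cesaroMean u n| ≤ cesaroMean v n := by
  rw [cesaroMean, abs_mul, abs_of_nonneg (by positivity : (0 : ℝ) ≤ (n : ℝ)⁻¹)]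
  exact mul_le_mul_of_nonneg_left ((Finset.abs_sum_le_sum_abs _ _).trans
    (Finset.sum_le_sum fun i _ => h i)) (by positivity)

theorem abs_cesaroMean_le_const {u : ℕ → ℝ} {C : ℝ} (h : ∀ i, |u i| ≤ C) (n : ℕ) :
    |cesaroMean u n| ≤ C := by
  have hC : 0 ≤ C := (abs_nonneg _).trans (h 0)
  refine (abs_cesaroMean_le h n).trans ?_
  rcases n.eq_zero_or_pos with rfl | hn
  · simpa [cesaroMean] using hC
  · simp [cesaroMean, hn.ne']

theorem abs_cesaroMean_succ_sub_le {u : ℕ → ℝ} {C : ℝ} (h : ∀ i, |u i| ≤ C) (n : ℕ) :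
    |cesaroMean u (n + 1) - cesaroMean u n| ≤ 2 * C / (n + 1) := by
  have hn : (0 : ℝ) < n + 1 := by positivity
  have e : cesaroMean u (n + 1) - cesaroMean u n = (u n - cesaroMean u n) / (n + 1) := by
    rcases n.eq_zero_or_pos with rfl | hn'
    · simp [cesaroMean]
    · have : (n : ℝ) ≠ 0 := by positivity
      simp only [cesaroMean, Finset.sum_range_succ, Nat.cast_add, Nat.cast_one]
      field_simp
      ring
  rw [e, abs_div, abs_of_pos hn]
  refine div_le_div_of_nonneg_right ((abs_sub _ _).trans ?_) hn.le
  linarith [h n, abs_cesaroMean_le_const h n]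

/-- Both terms are kept so that the bound depends on `n` alone, whichever of `m` and `n` is larger.
-/
theorem abs_cesaroMean_sub_le {u : ℕ → ℝ} {C : ℝ} (h : ∀ i, |u i| ≤ C) {m n : ℕ}
    (hmn : m ≤ n + 1) (hnm : n ≤ m + 1) :
    |cesaroMean u m - cesaroMean u n| ≤ 2 * C * (n : ℝ)⁻¹ + 2 * C * ((n + 1 : ℕ) : ℝ)⁻¹ := by
  have hC : 0 ≤ C := (abs_nonneg _).trans (h 0)
  obtain rfl | rfl | rfl : m = n + 1 ∨ m = n ∨ n = m + 1 := by omega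
  · have := abs_cesaroMean_succ_sub_le h n
    have h2 : 0 ≤ 2 * C * (n : ℝ)⁻¹ := by positivity
    rw [div_eq_mul_inv] at this
    push_cast
    linarith
  · rw [sub_self, abs_zero]
    positivity
  · have := abs_cesaroMean_succ_sub_le h m
    have h2 : 0 ≤ 2 * C * ((m + 1 + 1 : ℕ) : ℝ)⁻¹ := by positivity
    rw [div_eq_mul_inv] at this
    rw [abs_sub_comm]
    push_cast at h2 ⊢
    linarith

/-- In a countable group, the functions of an asymptotic paradox can be chosen to be
asymptotically right invariant. -/
theorem HasAsymptoticParadox.exists_asymptotically_invariant {G : Type*} [Group G] [Countable G]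
    (h : HasAsymptoticParadox G) :
    ∃ (κ : Type) (_ : Fintype κ) (g : κ → G) (C : ℝ) (a : κ → G → ℝ), (∀ k x, |a k x| ≤ C) ∧
      (∀ k h, Tendsto (fun x => a k (x * h) - a k x) cofinite (𝓝 0)) ∧
      ∀ᶠ x in cofinite, 1 / 2 ≤ ∑ k, (a k (g k * x) - a k x) := by
  obtain ⟨hinf, κ, _, g, C, hb⟩ := h
  obtain ⟨e, he⟩ := exists_surjective_nat G
  choose b hC hinv hpar using fun n : ℕ =>
    hb (e '' Set.Iic n) ((Set.finite_Iic n).image e) (1 / ((n : ℝ) + 1)) (by positivity)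
  -- The `n`-th inequality can fail at `x` only if `l x ≤ n`, so averaging over `n < l x` uses only
  -- valid inequalities.
  obtain ⟨l, hl, hlX, hlmul⟩ := exists_level_function
    (X := fun n => {x | ¬ 1 ≤ ∑ k, (b n k (g k * x) - b n k x)}) fun n => mem_cofinite.1 (hpar n)
  let a : κ → G → ℝ := fun k x => cesaroMean (fun n => b n k x) (l x)
  have hlim : Tendsto (fun n : ℕ => 2 * C * (n : ℝ)⁻¹ + 2 * C * ((n + 1 : ℕ) : ℝ)⁻¹) atTop
      (𝓝 0) := by
    have h1 : Tendsto (fun n : ℕ => (n : ℝ)⁻¹) atTop (𝓝 0) := tendsto_inv_atTop_nhds_zero_nat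
    simpa using (h1.const_mul (2 * C)).add ((h1.comp (tendsto_add_atTop_nat 1)).const_mul (2 * C))
  have hshift : ∀ (k : κ) (p : G → G),
      (∀ᶠ x in cofinite, l (p x) ≤ l x + 1 ∧ l x ≤ l (p x) + 1) →
      Tendsto (fun x => a k (p x) - cesaroMean (fun n => b n k (p x)) (l x)) cofinite (𝓝 0) := by
    intro k p hp
    refine squeeze_zero_norm' ?_ (hlim.comp hl)
    filter_upwards [hp] with x hx
    exact abs_cesaroMean_sub_le (fun i => hC i k (p x)) hx.1 hx.2
  refine ⟨κ, inferInstance, g, C, a, fun k x => abs_cesaroMean_le_const (fun i => hC i k x) _,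
    fun k s => ?_, ?_⟩
  · obtain ⟨j, rfl⟩ := he s
    -- Before stage `j` only the trivial bound is available; Cesàro averaging forgets these finitely
    -- many terms.
    let v : ℕ → ℝ := fun n => if j ≤ n then 1 / ((n : ℝ) + 1) else C + C
    have hv : Tendsto v atTop (𝓝 0) := by
      refine tendsto_one_div_add_atTop_nhds_zero_nat.congr' ?_
      filter_upwards [eventually_ge_atTop j] with n hn
      simp [v, hn]
    have h1 : Tendsto (fun x => cesaroMean (fun n => b n k (x * e j) - b n k x) (l x)) cofinite
        (𝓝 0) := by
      refine squeeze_zero_norm (fun x => ?_) (hv.cesaro.comp hl)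
      refine abs_cesaroMean_le (fun n => ?_) _
      simp only [v]
      split_ifs with hn
      · exact hinv n k _ ⟨j, hn, rfl⟩ x
      · exact (abs_sub _ _).trans (add_le_add (hC n k _) (hC n k _))
    have h2 := (hshift k _ (hlmul (e j)).2).add h1
    simp only [cesaroMean_sub, sub_add_sub_cancel, add_zero] at h2
    exact h2
  · have h1 : Tendsto (fun x => ∑ k, (a k (g k * x) -
        cesaroMean (fun n => b n k (g k * x)) (l x))) cofinite (𝓝 0) := by
      simpa using tendsto_finsetSum Finset.univ fun k _ => hshift k _ (hlmul (g k)).1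
    filter_upwards [h1.eventually (lt_mem_nhds (by norm_num : (-1 / 2 : ℝ) < 0)),
      hl.eventually_gt_atTop 0] with x hx hx0
    have h2 : 1 ≤ cesaroMean (fun n => ∑ k, (b n k (g k * x) - b n k x)) (l x) :=
      le_cesaroMean hx0 fun n hn => by
        by_contra hne
        exact absurd (hlX n x hne) (not_le.2 hn)
    rw [cesaroMean_sum fun k n => b n k (g k * x) - b n k x] at h2
    simp only [cesaroMean_sub] at h2
    have h3 : ∑ k, (a k (g k * x) - a k x) =
        ∑ k, (a k (g k * x) - cesaroMean (fun n => b n k (g k * x)) (l x)) +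
        ∑ k, (cesaroMean (fun n => b n k (g k * x)) (l x) -
          cesaroMean (fun n => b n k x) (l x)) := by
      rw [← Finset.sum_add_distrib]
      exact Finset.sum_congr rfl fun k _ => by simp [a]
    rw [h3]
    linarith

/-- Asymptotic positivity of a combination of differences can be improved to positivity
everywhere, by adding translates of a multiple of an indicator function. -/
theorem exists_forall_le_of_eventually_le {G : Type*} [Group G] [Infinite G] {κ : Type}
    [Fintype κ] {g : κ → G} {C : ℝ} {a : κ → G → ℝ} (hC : ∀ k x, |a k x| ≤ C)
    (ha : ∀ k h, Tendsto (fun x => a k (x * h) - a k x) cofinite (𝓝 0))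
    (hpar : ∀ᶠ x in cofinite, 1 / 2 ≤ ∑ k, (a k (g k * x) - a k x)) :
    ∃ (κ' : Type) (_ : Fintype κ') (g' : κ' → G) (C' : ℝ) (a' : κ' → G → ℝ),
      (∀ k x, |a' k x| ≤ C') ∧
      (∀ k h, Tendsto (fun x => a' k (x * h) - a' k x) cofinite (𝓝 0)) ∧
      ∀ x, 1 / 4 ≤ ∑ k, (a' k (g' k * x) - a' k x) := by
  classical
  have hfin := mem_cofinite.1 hpar
  set X : Finset G := hfin.toFinset with hXdef
  have hX : ∀ x, x ∉ X → 1 / 2 ≤ ∑ k, (a k (g k * x) - a k x) := fun x hx => by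
    by_contra hne
    exact hx (hfin.mem_toFinset.2 hne)
  -- The worst deficit on `X`, plus `1 / 2`. Subtracting `d x`, `N` times, gains `M` on `X`. As the
  -- `s j` are distinct, at most `X.card` of the points `s j * x` lie in `X`, so the loss is at most
  -- `X.card * M / N ≤ 1 / 4`.
  let M : ℝ := Fintype.card κ * |C + C| + 1 / 2
  have hM : 0 < M := by positivity
  have hlow : ∀ x, -(Fintype.card κ * |C + C|) ≤ ∑ k, (a k (g k * x) - a k x) := fun x => by
    have h1 : |∑ k, (a k (g k * x) - a k x)| ≤ ∑ k : κ, |C + C| :=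
      (Finset.abs_sum_le_sum_abs _ _).trans (Finset.sum_le_sum fun k _ =>
        (abs_sub _ _).trans ((add_le_add (hC k _) (hC k _)).trans (le_abs_self _)))
    simpa using (abs_le.1 h1).1
  obtain ⟨N, hN⟩ := exists_nat_gt (4 * M * X.card)
  have hN0 : (0 : ℝ) < N := lt_of_le_of_lt (by positivity) hN
  let s := Infinite.natEmbedding G
  let d : G → ℝ := fun x => if x ∈ X then -(M / N) else 0
  have hd : ∀ x, d x ≤ 0 := fun x => by
    simp only [d]
    split_ifs
    · exact neg_nonpos.2 (by positivity)
    · exact le_rfl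
  have hdev : d =ᶠ[cofinite] 0 := by
    refine mem_cofinite.2 (X.finite_toSet.subset fun x hx => ?_)
    by_contra hne
    exact hx (if_neg hne)
  have hdabs : ∀ x, |d x| ≤ M / N := fun x => by
    simp only [d]
    split_ifs
    · rw [abs_neg, abs_of_pos (by positivity)]
    · rw [abs_zero]; positivity
  have hdsum : ∀ x, -(1 / 4) ≤ ∑ j : Fin N, d (s j * x) := fun x => by
    have h1 : (Finset.univ.filter fun j : Fin N => s j * x ∈ X).card ≤ X.card := by
      refine Finset.card_le_card_of_injOn (fun j => s j * x) (fun j hj => ?_) fun i _ j _ hij => ?_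
      · exact (Finset.mem_filter.1 hj).2
      · exact Fin.ext (s.injective (mul_left_injective x hij))
    have h2 : ∑ j : Fin N, d (s j * x) =
        -((Finset.univ.filter fun j : Fin N => s j * x ∈ X).card * (M / N)) := by
      simp only [d]
      rw [← Finset.sum_filter, Finset.sum_const, nsmul_eq_mul]
      ring
    have h3 : ((Finset.univ.filter fun j : Fin N => s j * x ∈ X).card : ℝ) * (M / N) ≤
        X.card * (M / N) :=
      mul_le_mul_of_nonneg_right (Nat.cast_le.2 h1) (by positivity)
    have h4 : (X.card : ℝ) * (M / N) ≤ 1 / 4 := by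
      rw [← mul_div_assoc, div_le_iff₀ hN0]
      linarith
    rw [h2]
    linarith
  refine ⟨κ ⊕ Fin N, inferInstance, Sum.elim g fun j => s j, max C (M / N),
    Sum.elim a fun _ => d, ?_, ?_, fun x => ?_⟩
  · rintro (k | j) x
    · exact (hC k x).trans (le_max_left _ _)
    · exact (hdabs x).trans (le_max_right _ _)
  · rintro (k | j) h
    · exact ha k h
    · refine tendsto_const_nhds.congr' ?_
      filter_upwards [hdev, (mul_left_injective h).tendsto_cofinite.eventually hdev] with x h1 h2
      simp only [Sum.elim_inr]
      rw [h1, h2]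
      simp
  · rw [Fintype.sum_sum_type]
    simp only [Sum.elim_inl, Sum.elim_inr]
    rw [Finset.sum_sub_distrib (fun j : Fin N => d (s j * x)), Finset.sum_const, Finset.card_univ,
      Fintype.card_fin, nsmul_eq_mul]
    have h1 := hdsum x
    by_cases hx : x ∈ X
    · have h2 : (N : ℝ) * d x = -M := by
        simp only [d, if_pos hx]
        field_simp
      have h3 := hlow x
      rw [h2]
      simp only [M]
      linarith
    · have h2 : (N : ℝ) * d x = 0 := by simp [d, hx]
      have h3 := hX x hx
      rw [h2]
      linarith

/-! ### Orbit closures and the final equivalence -/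

theorem regular_dirac {K : Type*} [TopologicalSpace K] [T1Space K] [MeasurableSpace K]
    [BorelSpace K] (x : K) : (Measure.dirac x).Regular where
  lt_top_of_isCompact _ _ := measure_lt_top _ _
  outerRegular s hs r hr := by
    by_cases hx : x ∈ s
    · rw [Measure.dirac_apply' x hs, Set.indicator_of_mem hx, Pi.one_apply] at hr
      exact ⟨Set.univ, Set.subset_univ _, isOpen_univ, by simpa using hr⟩
    · refine ⟨{x}ᶜ, fun y hy hyx => hx (hyx ▸ hy), isOpen_compl_singleton, ?_⟩
      rw [Measure.dirac_apply' x (measurableSet_singleton x).compl]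
      simpa using pos_of_gt hr
  innerRegular U hU r hr := by
    by_cases hx : x ∈ U
    · rw [Measure.dirac_apply' x hU.measurableSet, Set.indicator_of_mem hx, Pi.one_apply] at hr
      exact ⟨{x}, Set.singleton_subset_iff.2 hx, isCompact_singleton, by simpa using hr⟩
    · rw [Measure.dirac_apply' x hU.measurableSet, Set.indicator_of_notMem hx] at hr
      exact absurd hr not_lt_zero

namespace CompactProbAction

/-- A point of a compact space with an action of `G`, as a probability measure on this space. -/
noncomputable def ofPoint {G : Type u} [Group G] {K : Type u} [TopologicalSpace K] [CompactSpace K]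
    [T2Space K] [MulAction G K] [ContinuousConstSMul G K] (x₀ : K) : CompactProbAction G :=
  letI : MeasurableSpace K := _root_.borel K
  haveI : BorelSpace K := ⟨rfl⟩
  { space := K
    η := Measure.dirac x₀
    regular := regular_dirac x₀ }

theorem poisson_ofPoint {G : Type u} [Group G] {K : Type u} [TopologicalSpace K] [CompactSpace K]
    [T2Space K] [MulAction G K] [ContinuousConstSMul G K] (x₀ : K)
    (f : C((ofPoint (G := G) x₀).space, ℝ)) (g : G) :
    (ofPoint (G := G) x₀).poisson f g = f (g • (x₀ : (ofPoint (G := G) x₀).space)) :=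
  integral_dirac' _ _ (f.smulComp g).continuous.stronglyMeasurable

end CompactProbAction

section OrbitClosure

variable {G : Type u} [Group G] {κ : Type}

/-- The family of all left translates of the functions `a k`, evaluated at a point. -/
def translateMap (a : κ → G → ℝ) (x : G) : G → κ → ℝ :=
  fun s k => a k (s * x)

/-- The closure of the set of values of `translateMap a`. -/
def translateClosure (a : κ → G → ℝ) : Set (G → κ → ℝ) :=
  closure (Set.range (translateMap a))

theorem isCompact_translateClosure {a : κ → G → ℝ} {C : ℝ} (hC : ∀ k x, |a k x| ≤ C) :
    IsCompact (translateClosure a) := by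
  refine (isCompact_univ_pi fun _ : G => isCompact_univ_pi fun _ : κ =>
    isCompact_Icc (a := -C) (b := C)).closure_of_subset ?_
  rintro _ ⟨x, rfl⟩ s - k -
  exact abs_le.1 (hC k _)

/-- Shifting the index carries the point of `x` to the point of `t * x`. -/
instance (a : κ → G → ℝ) : MulAction G (translateClosure a) where
  smul t z := ⟨fun s => z.1 (s * t), map_mem_closure (f := fun z s => z (s * t))
    (continuous_pi fun s => continuous_apply _) z.2 (by
      rintro _ ⟨x, rfl⟩
      exact ⟨t * x, by funext s k; simp [translateMap, mul_assoc]⟩)⟩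
  one_smul z := Subtype.ext (by
    funext s
    change z.1 (s * 1) = z.1 s
    rw [mul_one])
  mul_smul t t' z := Subtype.ext (by
    funext s
    change z.1 (s * (t * t')) = z.1 (s * t * t')
    rw [mul_assoc])

instance (a : κ → G → ℝ) : ContinuousConstSMul G (translateClosure a) :=
  ⟨fun t => continuous_induced_rng.2 (continuous_pi fun s =>
    (continuous_apply (s * t)).comp continuous_subtype_val)⟩

end OrbitClosure

/-- The inequality is a closed condition on coordinates, so it extends to the orbit closure and
gives a certificate. Asymptotic right invariance makes `x • z₀` and `(x * h) • z₀` converge to the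
same point along every nonprincipal ultrafilter. -/
theorem IsProperlyProximal.of_asymptotically_invariant {G : Type u} [Group G] {κ : Type}
    [Fintype κ] {g : κ → G} {C : ℝ} {a : κ → G → ℝ} (hC : ∀ k x, |a k x| ≤ C)
    (ha : ∀ k h, Tendsto (fun x => a k (x * h) - a k x) cofinite (𝓝 0)) {δ : ℝ} (hδ : 0 < δ)
    (hpar : ∀ x, δ ≤ ∑ k, (a k (g k * x) - a k x)) : IsProperlyProximal G := by
  have : CompactSpace (translateClosure a) :=
    isCompact_iff_compactSpace.1 (isCompact_translateClosure hC)
  let z₀ : translateClosure a := ⟨translateMap a 1, subset_closure ⟨1, rfl⟩⟩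
  have hz₀ : ∀ x s k, (x • z₀).1 s k = a k (s * x) := fun x s k => by
    change a k (s * x * 1) = _
    rw [mul_one]
  let f : κ → C(translateClosure a, ℝ) := fun k => ⟨fun z => δ⁻¹ * z.1 1 k,
    continuous_const.mul ((continuous_apply k).comp
      ((continuous_apply 1).comp continuous_subtype_val))⟩
  have hclosed : ∀ z ∈ translateClosure a, δ ≤ ∑ k, (z (g k) k - z 1 k) := by
    have hcl : IsClosed {z : G → κ → ℝ | δ ≤ ∑ k, (z (g k) k - z 1 k)} :=
      isClosed_le continuous_const (continuous_finsetSum _ fun k _ =>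
        (continuous_apply_apply (g k) k).sub (continuous_apply_apply 1 k))
    refine fun z hz => closure_minimal ?_ hcl hz
    rintro _ ⟨x, rfl⟩
    simpa [translateMap] using hpar x
  refine IsProperlyProximal.of_cover (fun _ : Unit => CompactProbAction.ofPoint z₀)
    (fun _ => (CompactProbAction.ofPoint z₀).not_hasInvariantProb_of_le (f := f) (g := g) ?_)
    fun ω hω => ⟨(), ?_⟩
  · intro z
    change 1 ≤ ∑ k, (δ⁻¹ * z.1 (1 * g k) k - δ⁻¹ * z.1 1 k)
    simp only [one_mul, ← mul_sub, ← Finset.mul_sum]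
    rw [le_inv_mul_iff₀ hδ, mul_one]
    exact hclosed z.1 z.2
  · rw [CompactProbAction.mem_proximalSet]
    intro h F
    simp only [CompactProbAction.poisson_ofPoint]
    have hω' := le_cofinite_of_mem_stoneCechBoundary hω
    obtain ⟨z, -, hz⟩ := isCompact_univ.ultrafilter_le_nhds (ω.map fun x : G => x • z₀) (by simp)
    have hz' : Tendsto (fun x : G => x • z₀) (ω : Filter G) (𝓝 z) := hz
    have hzh : Tendsto (fun x : G => (x * h) • z₀) (ω : Filter G) (𝓝 z) := by
      rw [tendsto_subtype_rng, tendsto_pi_nhds] at hz' ⊢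
      intro s
      have h1 := hz' s
      rw [tendsto_pi_nhds] at h1 ⊢
      intro k
      have h2 := (((ha k h).comp (mul_right_injective s).tendsto_cofinite).mono_left hω').add (h1 k)
      simpa [hz₀, mul_assoc, Function.comp_def] using h2
    have hF : Continuous (F : translateClosure a → ℝ) := F.continuous
    have h3 := ((hF.tendsto z).comp hzh).sub ((hF.tendsto z).comp hz')
    rw [sub_self] at h3
    exact h3

theorem HasAsymptoticParadox.isProperlyProximal {G : Type u} [Group G] [Countable G]
    (h : HasAsymptoticParadox G) : IsProperlyProximal G := by
  obtain ⟨κ, _, g, C, a, hC, ha, hpar⟩ := h.exists_asymptotically_invariant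
  have := h.1
  obtain ⟨κ', _, g', C', a', hC', ha', hpar'⟩ := exists_forall_le_of_eventually_le hC ha hpar
  exact IsProperlyProximal.of_asymptotically_invariant hC' ha' (by norm_num) hpar'

theorem CommensurableUpToFiniteKernels.symm {G : Type u} {H : Type v} [Group G] [Group H]
    (h : CommensurableUpToFiniteKernels G H) : CommensurableUpToFiniteKernels H G := by
  obtain ⟨G₀, H₀, N, M, hN, hM, hG₀, hH₀, hNf, hMf, ⟨e⟩⟩ := h
  exact ⟨H₀, G₀, M, N, hM, hN, hH₀, hG₀, hMf, hNf, ⟨e.symm⟩⟩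

/-- Co-amenability handles the descent to `G₀`; the paradox is then carried through both quotients
up to `H`, and countability serves only to return to an action of `H`. -/
theorem IsProperlyProximal.of_commensurable {G : Type u} {H : Type v} [Group G] [Group H]
    [Countable H] (h : CommensurableUpToFiniteKernels G H) (hG : IsProperlyProximal G) :
    IsProperlyProximal H := by
  obtain ⟨G₀, H₀, N, M, hN, hM, hG₀, hH₀, hNf, hMf, ⟨e⟩⟩ := h
  have h1 : HasAsymptoticParadox G₀ :=
    (hG.of_isCoamenable (G₀.isCoamenable_of_finiteIndex hG₀)).hasAsymptoticParadox
  have h2 : HasAsymptoticParadox (G₀ ⧸ N) :=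
    h1.map (QuotientGroup.mk' N) (QuotientGroup.mk'_surjective N)
      (by rw [QuotientGroup.ker_mk']; exact Set.toFinite _)
  have h3 : HasAsymptoticParadox (H₀ ⧸ M) :=
    h2.map e.toMonoidHom e.surjective (by
      rw [(MonoidHom.ker_eq_bot_iff _).2 e.injective]; exact Set.finite_singleton 1)
  have h4 : HasAsymptoticParadox H₀ :=
    h3.comap (QuotientGroup.mk' M) (QuotientGroup.mk'_surjective M)
      (by rw [QuotientGroup.ker_mk']; exact Set.toFinite _)
  exact (h4.of_finiteIndex hH₀).isProperlyProximal

theorem mainTheorem7 :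
    (∀ (ι : Type w) [Finite ι] [Nonempty ι] (G : ι → Type u) [∀ i, Group (G i)],
      (∀ i, IsProperlyProximal (G i)) → IsProperlyProximal (∀ i, G i)) ∧
    (∀ (G : Type u) [Group G] (H : Subgroup G),
      IsProperlyProximal G → H.IsCoamenable → IsProperlyProximal H) ∧
    (∀ (G : Type u) [Group G] (H : Subgroup G), H.FiniteIndex → H.IsCoamenable) ∧
    (∀ (G : Type u) (H : Type v) [Group G] [Group H] [Countable G] [Countable H],
      CommensurableUpToFiniteKernels G H → (IsProperlyProximal G ↔ IsProperlyProximal H)) :=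
  ⟨fun _ _ _ _ _ h => IsProperlyProximal.pi h, fun _ _ _ h hH => h.of_isCoamenable hH,
    fun _ _ H hH => H.isCoamenable_of_finiteIndex hH,
    fun _ _ _ _ _ _ h => ⟨fun hG => hG.of_commensurable h, fun hH => hH.of_commensurable h.symm⟩⟩
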